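/- For $x\in[0,1)$ let $a_n(x)$, $n\ge 1$, be the partial quotients of the continued fraction $x=[a_1(x),a_2(x),\dots]$, that is, $a_n(x)=\lfloor 1/T^{n-1}(x)\rfloor$ with the Gauss map $T(0)=0$, $T(x)=\frac1x \pmod 1$ for $x\in(0,1)$ (for rational $x$ the expansion is finite, and $a_n(x)$ is taken to be $0$ beyond its end). Let $m\ge 0$ be an integer, let $t_0,\dots,t_m\ge 0$ be real numbers, not all zero, and let $\varphi:\{1,2,3,\dots\}\to(0,\infty)$ satisfy $\varphi(n)\to\infty$ as $n\to\infty$. Put $$ND(\varphi)=\{x\in[0,1): a_n(x)^{t_0}a_{n+1}(x)^{t_1}\cdots a_{n+m}(x)^{t_m}\ge\varphi(n)\ \text{for all } n\ge 1\},$$ $$ND'(\varphi)=\{x\in[0,1): a_n(x)^{t_0}a_{n+1}(x)^{t_1}\cdots a_{n+m}(x)^{t_m}\ge\varphi(n)\ \text{for all sufficiently large } n\},$$ with the convention $0^0=1$, and let $A\in[1,\infty]$ be defined by $$\log A=\limsup_{n\to\infty}\frac{\log\log\varphi(n)}{n}\qquad(\log\infty=\infty).$$ Then $$\dim_H ND(\varphi)=\dim_H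 ND'(\varphi)=\frac1{1+A},$$ where $\dim_H$ denotes Hausdorff dimension and $\frac{1}{1+\infty}=0$. -/

import Mathlib

noncomputable section

/-- The Gauss transformation `T x = 1 / x (mod 1)`, with `T 0 = 0`
(in Lean `1 / 0 = 0`, so the formula covers `x = 0` as well). -/
def gaussMap (x : ℝ) : ℝ := Int.fract (1 / x)

/-- The `n`-th partial quotient `a_n(x) = ⌊1 / T^{n-1}(x)⌋`, for `n ≥ 1`, of the continued
fraction expansion of `x ∈ [0,1)`. For irrational `x` all of them are positive integers. When `x` is
rational its expansion is finite, and the value is `0` beyond its end. -/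
def partialQuotient (x : ℝ) (n : ℕ) : ℕ := ⌊1 / gaussMap^[n - 1] x⌋₊

/-- The weighted product `a_n(x)^{t_0} a_{n+1}(x)^{t_1} ⋯ a_{n+m}(x)^{t_m}`. -/
def weightedProduct {m : ℕ} (t : Fin (m + 1) → ℝ) (x : ℝ) (n : ℕ) : ℝ :=
  ∏ i : Fin (m + 1), (partialQuotient x (n + (i : ℕ)) : ℝ) ^ t i

/-- The points of `[0,1)` whose weighted product is at least `φ n` for all `n ≥ 1`. -/
def ND {m : ℕ} (t : Fin (m + 1) → ℝ) (φ : ℕ → ℝ) : Set ℝ :=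
  {x | x ∈ Set.Ico (0 : ℝ) 1 ∧ ∀ n : ℕ, 1 ≤ n → φ n ≤ weightedProduct t x n}

/-- The points of `[0,1)` whose weighted product is at least `φ n` for all large `n`. -/
def ND' {m : ℕ} (t : Fin (m + 1) → ℝ) (φ : ℕ → ℝ) : Set ℝ :=
  {x | x ∈ Set.Ico (0 : ℝ) 1 ∧ ∀ᶠ n : ℕ in Filter.atTop, φ n ≤ weightedProduct t x n}

end

/-!
The dimension is bounded from above by a covering and from below by an inverse Hölder map.

*Upper bound.* Write `P_n = a_1 ⋯ a_n`. Multiplying the weighted products shows that a positive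
power of `P_{n+m}` dominates the product of the first `n` of them; as they tend to infinity, `P_n`
eventually exceeds every geometric sequence (`eventually_pow_le_quotientProduct`). If `1 ≤ c < A`,
then moreover `a_{n+1} ≥ P_n ^ (c - 1)` for infinitely many `n`, since otherwise `log P_n = O(c ^ n)`
(`frequently_le_partialQuotient`). The points of the cylinder of `(a_1, …, a_n)` that satisfy this
inequality form a set of diameter at most `P_n ^ (-(c + 1))`, because the inverse branch of the
`n`-th iterate of the Gauss map contracts by `P_n ^ (-2)` and the `n`-th iterate takes values at most
`1 / a_{n+1}`. The sum over all words of `P_n ^ (-σ)` is a power `ζ(σ) ^ n` for `σ > 1`, and an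
arbitrarily small part of the exponent, applied to `P_n ≥ R ^ n`, compensates for it. Hence the
dimension is at most `1 / (1 + c)` (`dimH_rapidGrowth_le`). For `A = 1` the choice `c = 1` serves.

*Lower bound.* Let `B > A`, so that `φ n ≤ exp (B ^ n)` for large `n`. It suffices to find many points
with `a_{n+1} ≥ u n`, where `u n = ⌈exp (κ B ^ n)⌉` with `κ` large. Sending `y ∈ [0, 1)` with mixed
radix digits `d n < u n` to the point with partial quotients `u n + d n` gives an injection whose
inverse is Hölder with any exponent `s < 1 / (1 + B)` (`abs_sub_le_abs_radixPoint_sub_rpow`,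
`exists_radix_bases`). Since the inverse maps onto `[0, 1)`, the image has dimension at least `s`.
-/

open Filter Topology

/-! ### Cylinders of the Gauss map -/

lemma gaussMap_nonneg (x : ℝ) : 0 ≤ gaussMap x := Int.fract_nonneg _

lemma gaussMap_lt_one (x : ℝ) : gaussMap x < 1 := Int.fract_lt_one _

lemma gaussMap_iterate_mem {x : ℝ} (hx : x ∈ Set.Ico (0 : ℝ) 1) (n : ℕ) :
    gaussMap^[n] x ∈ Set.Ico (0 : ℝ) 1 := by
  cases n with
  | zero => exact hx
  | succ n =>
    rw [Function.iterate_succ_apply']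
    exact ⟨gaussMap_nonneg _, gaussMap_lt_one _⟩

lemma partialQuotient_succ (x : ℝ) (n : ℕ) :
    partialQuotient x (n + 1) = ⌊1 / gaussMap^[n] x⌋₊ := rfl

lemma partialQuotient_gaussMap (x : ℝ) (n : ℕ) :
    partialQuotient (gaussMap x) (n + 1) = partialQuotient x (n + 1 + 1) := by
  simp only [partialQuotient_succ, Function.iterate_succ_apply]

lemma partialQuotient_iterate (x : ℝ) (n : ℕ) :
    partialQuotient x (n + 1) = partialQuotient (gaussMap^[n] x) 1 := rfl

lemma one_div_eq_partialQuotient_add {x : ℝ} (hx : 0 ≤ x) :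
    1 / x = partialQuotient x 1 + gaussMap x := by
  have h : (0 : ℝ) ≤ 1 / x := by positivity
  simp only [partialQuotient, gaussMap, Nat.sub_self, Function.iterate_zero, id]
  rw [natCast_floor_eq_intCast_floor h]
  exact (Int.floor_add_fract _).symm

/-- The product `a_1(x) ⋯ a_n(x)` of the first `n` partial quotients. -/
noncomputable def quotientProduct (x : ℝ) (n : ℕ) : ℝ :=
  ∏ i ∈ Finset.range n, (partialQuotient x (i + 1) : ℝ)

lemma partialQuotient_ne_zero {x : ℝ} (hx : x ∈ Set.Ico (0 : ℝ) 1) (hirr : Irrational x) (n : ℕ) :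
    partialQuotient x (n + 1) ≠ 0 := by
  have hT : ∀ n, Irrational (gaussMap^[n] x) := by
    intro n
    induction n with
    | zero => exact hirr
    | succ n ih =>
      rw [Function.iterate_succ_apply']
      have h : Irrational (1 / gaussMap^[n] x) := by rw [one_div]; exact ih.inv
      rw [gaussMap, ← Int.self_sub_floor]
      exact h.sub_intCast _
  have hm := gaussMap_iterate_mem hx n
  have hpos : 0 < gaussMap^[n] x := lt_of_le_of_ne hm.1 (hT n).ne_zero.symm
  rw [partialQuotient_succ]
  have : 1 ≤ ⌊1 / gaussMap^[n] x⌋₊ := by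
    apply Nat.le_floor
    rw [Nat.cast_one, le_div_iff₀ hpos]
    linarith [hm.2]
  omega

/-- The distance of two points is that of their images under one step of the Gauss map, divided
by the two denominators. -/
lemma abs_sub_eq_of_partialQuotient {x y : ℝ} (hx : 0 ≤ x) (hy : 0 ≤ y)
    (hax : partialQuotient x 1 ≠ 0) (hay : partialQuotient y 1 ≠ 0) :
    |x - y| = |(partialQuotient x 1 + gaussMap x) - (partialQuotient y 1 + gaussMap y)| /
      ((partialQuotient x 1 + gaussMap x) * (partialQuotient y 1 + gaussMap y)) := by
  have ex := one_div_eq_partialQuotient_add hx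
  have ey := one_div_eq_partialQuotient_add hy
  have hu : (0 : ℝ) < partialQuotient x 1 + gaussMap x :=
    add_pos_of_pos_of_nonneg (by positivity) (gaussMap_nonneg _)
  have hv : (0 : ℝ) < partialQuotient y 1 + gaussMap y :=
    add_pos_of_pos_of_nonneg (by positivity) (gaussMap_nonneg _)
  set u := (partialQuotient x 1 : ℝ) + gaussMap x
  set v := (partialQuotient y 1 : ℝ) + gaussMap y
  have ex' : x = 1 / u := by rw [← ex, one_div_one_div]
  have ey' : y = 1 / v := by rw [← ey, one_div_one_div]
  rw [ex', ey', ← abs_of_pos (mul_pos hu hv), ← abs_div, abs_sub_comm]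
  congr 1
  field_simp

lemma quotientProduct_gaussMap (x : ℝ) (n : ℕ) :
    quotientProduct x (n + 1) = partialQuotient x 1 * quotientProduct (gaussMap x) n := by
  simp only [quotientProduct]
  rw [Finset.prod_range_succ', mul_comm]
  simp only [partialQuotient_gaussMap, zero_add]

lemma quotientProduct_succ (x : ℝ) (n : ℕ) :
    quotientProduct x (n + 1) = quotientProduct x n * partialQuotient x (n + 1) :=
  Finset.prod_range_succ _ _

lemma one_le_quotientProduct {x : ℝ} (ha : ∀ n, partialQuotient x (n + 1) ≠ 0) (n : ℕ) :
    1 ≤ quotientProduct x n := by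
  induction n with
  | zero => simp [quotientProduct]
  | succ n ih =>
    rw [quotientProduct_succ]
    have : (1 : ℝ) ≤ partialQuotient x (n + 1) := by
      exact_mod_cast Nat.one_le_iff_ne_zero.2 (ha n)
    nlinarith

/-- The inverse branches of the `n`-th iterate of the Gauss map contract by `(a_1 ⋯ a_n)⁻²`. -/
lemma abs_sub_le_of_partialQuotient_eq (n : ℕ) {x y : ℝ} (hx : 0 ≤ x) (hy : 0 ≤ y)
    (hax : ∀ i, partialQuotient x (i + 1) ≠ 0) (hay : ∀ i, partialQuotient y (i + 1) ≠ 0)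
    (h : ∀ i < n, partialQuotient x (i + 1) = partialQuotient y (i + 1)) :
    |x - y| ≤ |gaussMap^[n] x - gaussMap^[n] y| / quotientProduct x n ^ 2 := by
  induction n generalizing x y with
  | zero => simp [quotientProduct]
  | succ n ih =>
    have h0 : partialQuotient x 1 = partialQuotient y 1 := h 0 (by omega)
    have ih' := ih (gaussMap_nonneg x) (gaussMap_nonneg y)
      (fun i => by rw [partialQuotient_gaussMap]; exact hax _)
      (fun i => by rw [partialQuotient_gaussMap]; exact hay _)
      (fun i hi => by
        rw [partialQuotient_gaussMap, partialQuotient_gaussMap]; exact h (i + 1) (by omega))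
    have ha : (0 : ℝ) < partialQuotient x 1 := by
      exact_mod_cast Nat.pos_of_ne_zero (hax 0)
    rw [abs_sub_eq_of_partialQuotient hx hy (hax 0) (hay 0), ← h0, add_sub_add_left_eq_sub,
      quotientProduct_gaussMap, Function.iterate_succ_apply, Function.iterate_succ_apply]
    calc _ ≤ |gaussMap x - gaussMap y| / (partialQuotient x 1 * partialQuotient x 1) := by
          gcongr <;> linarith [gaussMap_nonneg x, gaussMap_nonneg y]
      _ ≤ |gaussMap^[n] (gaussMap x) - gaussMap^[n] (gaussMap y)| /
            quotientProduct (gaussMap x) n ^ 2 / (partialQuotient x 1 * partialQuotient x 1) := by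
          gcongr
      _ = _ := by rw [div_div]; congr 1; ring

/-- The inverse branches of the `n`-th iterate of the Gauss map contract distances by a
factor no smaller than `((a_1 + 1) ⋯ (a_n + 1))⁻²`. -/
lemma le_abs_sub_of_partialQuotient_eq (n : ℕ) {x y : ℝ} (hx : 0 ≤ x) (hy : 0 ≤ y)
    (hax : ∀ i, partialQuotient x (i + 1) ≠ 0) (hay : ∀ i, partialQuotient y (i + 1) ≠ 0)
    (h : ∀ i < n, partialQuotient x (i + 1) = partialQuotient y (i + 1)) :
    |gaussMap^[n] x - gaussMap^[n] y| /
      (∏ i ∈ Finset.range n, ((partialQuotient x (i + 1) : ℝ) + 1)) ^ 2 ≤ |x - y| := by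
  induction n generalizing x y with
  | zero => simp
  | succ n ih =>
    have h0 : partialQuotient x 1 = partialQuotient y 1 := h 0 (by omega)
    have ih' := ih (gaussMap_nonneg x) (gaussMap_nonneg y)
      (fun i => by rw [partialQuotient_gaussMap]; exact hax _)
      (fun i => by rw [partialQuotient_gaussMap]; exact hay _)
      (fun i hi => by
        rw [partialQuotient_gaussMap, partialQuotient_gaussMap]; exact h (i + 1) (by omega))
    simp only [partialQuotient_gaussMap] at ih'
    have ha : (0 : ℝ) < partialQuotient x 1 := by
      exact_mod_cast Nat.pos_of_ne_zero (hax 0)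
    have hgx := gaussMap_nonneg x
    have hgy := gaussMap_nonneg y
    rw [abs_sub_eq_of_partialQuotient hx hy (hax 0) (hay 0), ← h0, add_sub_add_left_eq_sub,
      Finset.prod_range_succ', Function.iterate_succ_apply, Function.iterate_succ_apply]
    calc _ = |gaussMap^[n] (gaussMap x) - gaussMap^[n] (gaussMap y)| /
            (∏ i ∈ Finset.range n, ((partialQuotient x (i + 1 + 1) : ℝ) + 1)) ^ 2 /
            ((partialQuotient x 1 + 1) * (partialQuotient x 1 + 1)) := by
          rw [div_div]; congr 1; ring
      _ ≤ |gaussMap x - gaussMap y| / ((partialQuotient x 1 + 1) * (partialQuotient x 1 + 1)) := by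
          gcongr
      _ ≤ _ := by
          gcongr <;> linarith [gaussMap_lt_one x, gaussMap_lt_one y]

/-! ### Covering a set of rapid growth -/

lemma ENNReal.tsum_pi_fin_prod {α : Type*} (f : α → ENNReal) (n : ℕ) :
    ∑' w : Fin n → α, ∏ i, f (w i) = (∑' a, f a) ^ n := by
  induction n with
  | zero => simp
  | succ n ih =>
    rw [← (Fin.consEquiv fun _ : Fin (n + 1) => α).tsum_eq, ENNReal.tsum_prod', pow_succ']
    simp only [Fin.consEquiv_apply, Fin.prod_univ_succ, Fin.cons_zero, Fin.cons_succ,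
      ENNReal.tsum_mul_left, ENNReal.tsum_mul_right]
    rw [ih]

/-- The points with an infinite expansion for which `a_1 ⋯ a_n` grows faster than every geometric
sequence, and `a_{n+1} ≥ (a_1 ⋯ a_n)^{c-1}` for infinitely many `n`. -/
def rapidGrowth (c : ℝ) : Set ℝ :=
  {x | x ∈ Set.Ico (0 : ℝ) 1 ∧ (∀ n, partialQuotient x (n + 1) ≠ 0) ∧
    (∀ R : ℝ, ∀ᶠ n in atTop, R ^ n ≤ quotientProduct x n) ∧
    ∃ᶠ n in atTop, quotientProduct x n ^ (c - 1) ≤ partialQuotient x (n + 1)}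

/-- The points with an infinite expansion beginning with the word `w` of length `n` that satisfy both
inequalities in the definition of `rapidGrowth c` at the index `n`, the first one for the given `R`. -/
def rapidCylinder (c R : ℝ) (n : ℕ) (w : Fin n → ℕ) : Set ℝ :=
  {x | x ∈ Set.Ico (0 : ℝ) 1 ∧ (∀ n, partialQuotient x (n + 1) ≠ 0) ∧
    (∀ i : Fin n, partialQuotient x (i + 1) = w i) ∧ R ^ n ≤ quotientProduct x n ∧
    quotientProduct x n ^ (c - 1) ≤ partialQuotient x (n + 1)}

lemma quotientProduct_eq_of_mem {c R x : ℝ} {n : ℕ} {w : Fin n → ℕ}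
    (hx : x ∈ rapidCylinder c R n w) : quotientProduct x n = ∏ i, (w i : ℝ) := by
  rw [quotientProduct, ← Fin.prod_univ_eq_prod_range (fun i => (partialQuotient x (i + 1) : ℝ))]
  exact Finset.prod_congr rfl fun i _ => by rw [hx.2.2.1 i]

lemma gaussMap_iterate_le_of_mem {c R x : ℝ} {n : ℕ} {w : Fin n → ℕ}
    (hx : x ∈ rapidCylinder c R n w) :
    gaussMap^[n] x ≤ (∏ i, (w i : ℝ)) ^ (1 - c) := by
  have h1 := quotientProduct_eq_of_mem hx
  have hP := one_le_quotientProduct hx.2.1 n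
  have hg := gaussMap_iterate_mem hx.1 n
  have ha : (0 : ℝ) < partialQuotient x (n + 1) := by
    exact_mod_cast Nat.pos_of_ne_zero (hx.2.1 n)
  have hle : (partialQuotient x (n + 1) : ℝ) ≤ 1 / gaussMap^[n] x := by
    rw [partialQuotient_succ]
    exact Nat.floor_le (by have := hg.1; positivity)
  have h2 := hx.2.2.2.2.trans hle
  have h3 : 0 < quotientProduct x n ^ (c - 1) := by positivity
  have h4 := one_div_le_one_div_of_le h3 h2
  rw [one_div_one_div] at h4
  rwa [← h1, ← neg_sub c 1, Real.rpow_neg (by linarith), ← one_div]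

lemma ediam_rapidCylinder_le {c R : ℝ} (n : ℕ) (w : Fin n → ℕ) :
    Metric.ediam (rapidCylinder c R n w) ≤ ENNReal.ofReal ((∏ i, (w i : ℝ)) ^ (-(c + 1))) := by
  apply Metric.ediam_le
  intro x hx y hy
  rw [edist_dist, Real.dist_eq]
  apply ENNReal.ofReal_le_ofReal
  have hP := one_le_quotientProduct hx.2.1 n
  have h := abs_sub_le_of_partialQuotient_eq n hx.1.1 hy.1.1 hx.2.1 hy.2.1 (fun i hi => by
    rw [hx.2.2.1 ⟨i, hi⟩, hy.2.2.1 ⟨i, hi⟩])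
  have hgx := gaussMap_iterate_mem hx.1 n
  have hgy := gaussMap_iterate_mem hy.1 n
  have h1 := gaussMap_iterate_le_of_mem hx
  have h2 := gaussMap_iterate_le_of_mem hy
  rw [quotientProduct_eq_of_mem hx] at h hP
  refine h.trans ?_
  have hPpos : 0 < ∏ i, (w i : ℝ) := by linarith
  have e : (∏ i, (w i : ℝ)) ^ (-(c + 1)) = (∏ i, (w i : ℝ)) ^ (1 - c) / (∏ i, (w i : ℝ)) ^ 2 := by
    rw [← Real.rpow_natCast, ← Real.rpow_sub hPpos]
    congr 1
    push_cast
    ring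
  rw [e]
  gcongr
  rw [abs_le]
  constructor <;> linarith [hgx.1, hgy.1]

lemma ediam_rapidCylinder_rpow_le {c R s σ : ℝ} (hs : 0 ≤ s) (hR : 0 < R)
    (hσ : σ ≤ (c + 1) * s) (n : ℕ) (w : Fin n → ℕ) (hne : (rapidCylinder c R n w).Nonempty) :
    Metric.ediam (rapidCylinder c R n w) ^ s ≤
      ENNReal.ofReal (R ^ (σ - (c + 1) * s)) ^ n * ∏ i, ENNReal.ofReal ((w i : ℝ) ^ (-σ)) := by
  obtain ⟨x, hx⟩ := hne
  have hP := one_le_quotientProduct hx.2.1 n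
  have hPR := hx.2.2.2.1
  rw [quotientProduct_eq_of_mem hx] at hP hPR
  have hPpos : 0 < ∏ i, (w i : ℝ) := by linarith
  calc _ ≤ ENNReal.ofReal ((∏ i, (w i : ℝ)) ^ (-(c + 1))) ^ s := by
        gcongr; exact ediam_rapidCylinder_le n w
    _ = ENNReal.ofReal ((∏ i, (w i : ℝ)) ^ (σ - (c + 1) * s) * (∏ i, (w i : ℝ)) ^ (-σ)) := by
        rw [ENNReal.ofReal_rpow_of_nonneg (by positivity) hs, ← Real.rpow_mul hPpos.le,
          ← Real.rpow_add hPpos]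
        congr 2
        ring
    _ ≤ ENNReal.ofReal ((R ^ n) ^ (σ - (c + 1) * s) * (∏ i, (w i : ℝ)) ^ (-σ)) := by
        apply ENNReal.ofReal_le_ofReal
        gcongr ?_ * _
        exact Real.rpow_le_rpow_of_nonpos (by positivity) hPR (by linarith)
    _ = _ := by
        rw [ENNReal.ofReal_mul (by positivity), ← ENNReal.ofReal_pow (by positivity),
          ← ENNReal.ofReal_prod_of_nonneg (fun i _ => by positivity),
          Real.finsetProd_rpow _ _ (fun i _ => by positivity), ← Real.rpow_natCast,
          ← Real.rpow_mul hR.le, mul_comm (n : ℝ), Real.rpow_mul hR.le, Real.rpow_natCast]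

lemma ediam_rapidCylinder_le_pow {c R : ℝ} (hc : 0 ≤ c) (hR : 2 ≤ R) (n : ℕ) (w : Fin n → ℕ) :
    Metric.ediam (rapidCylinder c R n w) ≤ (1 / 2 : ENNReal) ^ n := by
  rcases (rapidCylinder c R n w).eq_empty_or_nonempty with h | ⟨x, hx⟩
  · simp [h]
  have hP := one_le_quotientProduct hx.2.1 n
  have hPR := hx.2.2.2.1
  rw [quotientProduct_eq_of_mem hx] at hP hPR
  refine (ediam_rapidCylinder_le n w).trans ?_
  calc _ ≤ ENNReal.ofReal ((1 / 2) ^ n) := by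
        apply ENNReal.ofReal_le_ofReal
        calc _ ≤ (∏ i, (w i : ℝ)) ^ (-1 : ℝ) := Real.rpow_le_rpow_of_exponent_le hP (by linarith)
          _ ≤ (1 / 2) ^ n := by
            rw [Real.rpow_neg_one, one_div, inv_pow]
            gcongr
            exact le_trans (by gcongr) hPR
    _ = _ := by
        rw [ENNReal.ofReal_pow (by norm_num), ENNReal.ofReal_div_of_pos (by norm_num)]
        simp

lemma exists_ofReal_rpow_mul_le_half {δ : ℝ} (hδ : δ < 0) {Z : ENNReal} (hZ : Z ≠ ⊤) :
    ∃ R : ℝ, 2 ≤ R ∧ ENNReal.ofReal (R ^ δ) * Z ≤ 1 / 2 := by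
  have h1 : Tendsto (fun R : ℝ => ENNReal.ofReal (R ^ δ) * Z) atTop (𝓝 (ENNReal.ofReal 0 * Z)) := by
    apply ENNReal.Tendsto.mul_const _ (Or.inr hZ)
    apply ENNReal.tendsto_ofReal
    have := tendsto_rpow_neg_atTop (neg_pos.2 hδ)
    rwa [neg_neg] at this
  rw [ENNReal.ofReal_zero, zero_mul] at h1
  have h2 : ∀ᶠ R : ℝ in atTop, ENNReal.ofReal (R ^ δ) * Z ≤ 1 / 2 :=
    h1.eventually (eventually_le_nhds (by simp))
  obtain ⟨R, hR, h⟩ := ((eventually_ge_atTop 2).and h2).exists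
  exact ⟨R, hR, h⟩

/-- Covering by cylinders: the sum over all words of length `n` factorizes, and the superexponential
growth of `a_1 ⋯ a_n` pays for the `n`-th power of the zeta value that comes out. -/
lemma dimH_rapidGrowth_le {c : ℝ} (hc : 1 ≤ c) {s : NNReal} (hs : 1 < (c + 1) * s) :
    dimH (rapidGrowth c) ≤ s := by
  obtain ⟨σ, h1σ, hσ⟩ := exists_between hs
  have hsum : Summable fun k : ℕ => (k : ℝ) ^ (-σ) := Real.summable_nat_rpow.2 (by linarith)
  have hZ : ∑' k : ℕ, ENNReal.ofReal ((k : ℝ) ^ (-σ)) ≠ ⊤ := by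
    rw [← ENNReal.ofReal_tsum_of_nonneg (fun k => by positivity) hsum]
    exact ENNReal.ofReal_ne_top
  obtain ⟨R, hR2, hR⟩ := exists_ofReal_rpow_mul_le_half (sub_neg.2 hσ) hZ
  apply dimH_le_of_hausdorffMeasure_ne_top
  -- For each `N`, the cover uses all words of length at least `N`; its sets of smaller index are
  -- empty.
  let U : ℕ → (Σ n, Fin n → ℕ) → Set ℝ := fun N p =>
    {x | N ≤ p.1 ∧ x ∈ rapidCylinder c R p.1 p.2}
  have hUsub : ∀ N p, U N p ⊆ rapidCylinder c R p.1 p.2 := fun N p x hx => hx.2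
  have hr : Tendsto (fun N : ℕ => (1 / 2 : ENNReal) ^ N) atTop (𝓝 0) :=
    ENNReal.tendsto_pow_atTop_nhds_zero_of_lt_one (by simp)
  have key := MeasureTheory.Measure.hausdorffMeasure_le_liminf_tsum (s : ℝ) (rapidGrowth c) _ hr U
    (Eventually.of_forall fun N p => by
      by_cases hp : N ≤ p.1
      · exact (Metric.ediam_mono (hUsub N p)).trans
          ((ediam_rapidCylinder_le_pow (by linarith) hR2 _ _).trans
            (pow_le_pow_of_le_one (by simp) (by simp) hp))
      · simp [U, hp])
    (Eventually.of_forall fun N x hx => by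
      obtain ⟨hx0, hxa, hxR, hxf⟩ := hx
      obtain ⟨n, hn, hnN, hnR⟩ := (hxf.and_eventually
        ((eventually_ge_atTop N).and (hxR R))).exists
      exact Set.mem_iUnion.2 ⟨⟨n, fun i => partialQuotient x (i + 1)⟩, hnN, hx0, hxa,
        fun i => rfl, hnR, hn⟩)
  refine ne_top_of_le_ne_top (b := 2) (by simp) (key.trans ?_)
  refine (liminf_le_liminf (v := fun _ : ℕ => (2 : ENNReal)) ?_).trans (by simp)
  refine Eventually.of_forall fun N => ?_
  have hs0 : 0 < (s : ℝ) := by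
    by_contra h
    have : (s : ℝ) = 0 := le_antisymm (not_lt.1 h) s.2
    rw [this] at hs
    linarith
  have hle : ∀ p : Σ n, Fin n → ℕ, Metric.ediam (U N p) ^ (s : ℝ) ≤
      ENNReal.ofReal (R ^ (σ - (c + 1) * s)) ^ p.1 *
        ∏ i, ENNReal.ofReal ((p.2 i : ℝ) ^ (-σ)) := by
    intro p
    rcases (rapidCylinder c R p.1 p.2).eq_empty_or_nonempty with h | h
    · have : U N p = ∅ := Set.subset_empty_iff.1 (h ▸ hUsub N p)
      simp [this, ENNReal.zero_rpow_of_pos hs0]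
    · exact (ENNReal.rpow_le_rpow (Metric.ediam_mono (hUsub N p)) s.2).trans
        (ediam_rapidCylinder_rpow_le s.2 (by linarith) hσ.le p.1 p.2 h)
  calc _ ≤ ∑' p : Σ n, Fin n → ℕ, ENNReal.ofReal (R ^ (σ - (c + 1) * s)) ^ p.1 *
        ∏ i, ENNReal.ofReal ((p.2 i : ℝ) ^ (-σ)) := ENNReal.tsum_le_tsum hle
    _ = ∑' n : ℕ, (ENNReal.ofReal (R ^ (σ - (c + 1) * s)) *
          ∑' k : ℕ, ENNReal.ofReal ((k : ℝ) ^ (-σ))) ^ n := by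
        rw [ENNReal.tsum_sigma']
        refine tsum_congr fun n => ?_
        dsimp only
        rw [ENNReal.tsum_mul_left,
          ENNReal.tsum_pi_fin_prod (fun k : ℕ => ENNReal.ofReal ((k : ℝ) ^ (-σ))), mul_pow]
    _ ≤ ∑' n : ℕ, (1 / 2 : ENNReal) ^ n := ENNReal.tsum_le_tsum fun n => by gcongr
    _ ≤ 2 := by rw [ENNReal.tsum_geometric]; simp

/-! ### Growth forced by the weighted products -/

lemma log_quotientProduct {x : ℝ} (ha : ∀ n, partialQuotient x (n + 1) ≠ 0) (n : ℕ) :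
    Real.log (quotientProduct x n) =
      ∑ k ∈ Finset.range n, Real.log (partialQuotient x (k + 1)) :=
  Real.log_prod fun i _ => by exact_mod_cast ha i

lemma one_le_weightedProduct {m : ℕ} {t : Fin (m + 1) → ℝ} (ht : ∀ i, 0 ≤ t i) {x : ℝ}
    (ha : ∀ n, partialQuotient x (n + 1) ≠ 0) (n : ℕ) : 1 ≤ weightedProduct t x (n + 1) := by
  refine Finset.one_le_prod fun i _ => ?_
  rw [Nat.add_right_comm]
  exact Real.one_le_rpow (Nat.one_le_cast.2 (Nat.one_le_iff_ne_zero.2 (ha _))) (ht i)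

lemma log_weightedProduct {m : ℕ} (t : Fin (m + 1) → ℝ) {x : ℝ}
    (ha : ∀ n, partialQuotient x (n + 1) ≠ 0) (n : ℕ) :
    Real.log (weightedProduct t x (n + 1)) =
      ∑ i : Fin (m + 1), t i * Real.log (partialQuotient x (i + n + 1)) := by
  have hpos : ∀ i : Fin (m + 1), (0 : ℝ) < partialQuotient x (n + 1 + i) := fun i => by
    rw [Nat.add_right_comm]
    exact_mod_cast Nat.pos_of_ne_zero (ha _)
  rw [weightedProduct, Real.log_prod fun i _ => (Real.rpow_pos_of_pos (hpos i) _).ne']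
  refine Finset.sum_congr rfl fun i _ => ?_
  rw [Real.log_rpow (hpos i), Nat.add_right_comm, Nat.add_comm n]

/-- Each partial quotient occurs in the weighted products with total exponent at most `∑ i, t i`. -/
lemma sum_log_weightedProduct_le {m : ℕ} {t : Fin (m + 1) → ℝ} (ht : ∀ i, 0 ≤ t i) {x : ℝ}
    (ha : ∀ n, partialQuotient x (n + 1) ≠ 0) (n : ℕ) :
    ∑ j ∈ Finset.range n, Real.log (weightedProduct t x (j + 1)) ≤
      (∑ i, t i) * Real.log (quotientProduct x (n + m)) := by
  simp only [log_weightedProduct t ha]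
  rw [Finset.sum_comm, Finset.sum_mul]
  refine Finset.sum_le_sum fun i _ => ?_
  rw [← Finset.mul_sum]
  refine mul_le_mul_of_nonneg_left ?_ (ht i)
  have hL : ∀ k, 0 ≤ Real.log (partialQuotient x (k + 1)) := fun k => Real.log_natCast_nonneg _
  rw [log_quotientProduct ha]
  have h1 := Finset.sum_range_add (fun k => Real.log (partialQuotient x (k + 1) : ℝ)) i n
  have h2 : 0 ≤ ∑ k ∈ Finset.range i, Real.log (partialQuotient x (k + 1)) :=
    Finset.sum_nonneg fun k _ => hL k
  have h3 : ∑ k ∈ Finset.range (i + n), Real.log (partialQuotient x (k + 1)) ≤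
      ∑ k ∈ Finset.range (n + m), Real.log (partialQuotient x (k + 1)) :=
    Finset.sum_le_sum_of_subset_of_nonneg
      (Finset.range_subset_range.2 (by have := i.2; omega)) fun k _ _ => hL k
  linarith

lemma log_weightedProduct_le {m : ℕ} {t : Fin (m + 1) → ℝ} (ht : ∀ i, 0 ≤ t i) {x : ℝ}
    (ha : ∀ n, partialQuotient x (n + 1) ≠ 0) (n : ℕ) :
    Real.log (weightedProduct t x (n + 1)) ≤
      (∑ i, t i) * Real.log (quotientProduct x (n + 1 + m)) :=
  (Finset.single_le_sum (f := fun j => Real.log (weightedProduct t x (j + 1)))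
    (fun j _ => Real.log_nonneg (one_le_weightedProduct ht ha j))
    (Finset.self_mem_range_succ n)).trans (sum_log_weightedProduct_le ht ha (n + 1))

lemma eventually_pow_le_quotientProduct {m : ℕ} {t : Fin (m + 1) → ℝ} (ht : ∀ i, 0 ≤ t i)
    (ht0 : ∃ i, t i ≠ 0) {x : ℝ} (ha : ∀ n, partialQuotient x (n + 1) ≠ 0)
    (hW : Tendsto (weightedProduct t x) atTop atTop) (R : ℝ) :
    ∀ᶠ n in atTop, R ^ n ≤ quotientProduct x n := by
  have hτ : 0 < ∑ i, t i := by
    obtain ⟨i, hi⟩ := ht0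
    exact Finset.sum_pos' (fun i _ => ht i) ⟨i, Finset.mem_univ i, lt_of_le_of_ne (ht i) hi.symm⟩
  set τ := ∑ i, t i
  have hr1 : 1 ≤ max |R| 1 := le_max_right _ _
  set r := max |R| 1
  -- With this threshold, the `N + m` indices that give no lower bound are absorbed by the factor `2`
  -- as soon as `n ≥ 2 (m + N)`.
  have hρ : 0 ≤ Real.log r := Real.log_nonneg hr1
  have hlogW : Tendsto (fun n => Real.log (weightedProduct t x (n + 1))) atTop atTop :=
    Real.tendsto_log_atTop.comp ((tendsto_add_atTop_iff_nat 1).2 hW)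
  obtain ⟨N, hN⟩ := eventually_atTop.1 (hlogW.eventually_ge_atTop (2 * τ * Real.log r))
  filter_upwards [eventually_ge_atTop (2 * (m + N))] with n hn
  obtain ⟨k, rfl⟩ : ∃ k, n = N + k + m := ⟨n - N - m, by omega⟩
  have h1 := sum_log_weightedProduct_le ht ha (N + k)
  rw [Finset.sum_range_add] at h1
  have h2 : 0 ≤ ∑ j ∈ Finset.range N, Real.log (weightedProduct t x (j + 1)) :=
    Finset.sum_nonneg fun j _ => Real.log_nonneg (one_le_weightedProduct ht ha j)
  have h3 : (k : ℝ) * (2 * τ * Real.log r) ≤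
      ∑ j ∈ Finset.range k, Real.log (weightedProduct t x (N + j + 1)) := by
    have := Finset.card_nsmul_le_sum (Finset.range k)
      (fun j => Real.log (weightedProduct t x (N + j + 1))) _ (fun j _ => hN (N + j) (by omega))
    simpa using this
  have h4 : 2 * k * Real.log r ≤ Real.log (quotientProduct x (N + k + m)) := by
    refine le_of_mul_le_mul_left ?_ hτ
    calc _ = (k : ℝ) * (2 * τ * Real.log r) := by ring
      _ ≤ _ := by linarith
  have h5 : ((N + k + m : ℕ) : ℝ) * Real.log r ≤ Real.log (quotientProduct x (N + k + m)) := by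
    refine le_trans ?_ h4
    gcongr
    exact_mod_cast (by omega : N + k + m ≤ 2 * k)
  have hP := one_le_quotientProduct ha (N + k + m)
  calc R ^ (N + k + m) ≤ |R| ^ (N + k + m) := by rw [← abs_pow]; exact le_abs_self _
    _ ≤ r ^ (N + k + m) := by gcongr; exact le_max_left _ _
    _ ≤ _ := by
      rw [← Real.log_le_log_iff (by positivity) (by linarith), Real.log_pow]
      exact h5

/-- If `a_{n+1} < (a_1 ⋯ a_n)^{c-1}` from some index on, then `log (a_1 ⋯ a_n) = O(c ^ n)`, which
contradicts the size of the weighted products. -/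
lemma frequently_le_partialQuotient {m : ℕ} {t : Fin (m + 1) → ℝ} (ht : ∀ i, 0 ≤ t i)
    {x c c' : ℝ} (ha : ∀ n, partialQuotient x (n + 1) ≠ 0) (hc : 1 ≤ c) (hcc' : c < c')
    (hW : ∃ᶠ n in atTop, Real.exp (c' ^ n) ≤ weightedProduct t x n) :
    ∃ᶠ n in atTop, quotientProduct x n ^ (c - 1) ≤ partialQuotient x (n + 1) := by
  intro hev
  obtain ⟨N, hN⟩ := eventually_atTop.1 hev
  have hS : ∀ n, 0 ≤ Real.log (quotientProduct x n) := fun n =>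
    Real.log_nonneg (one_le_quotientProduct ha n)
  have hstep : ∀ n, N ≤ n →
      Real.log (quotientProduct x (n + 1)) ≤ c * Real.log (quotientProduct x n) := by
    intro n hn
    have h1 := not_le.1 (hN n hn)
    have hP : 0 < quotientProduct x n := by linarith [one_le_quotientProduct ha n]
    have hpos : (0 : ℝ) < partialQuotient x (n + 1) := by
      exact_mod_cast Nat.pos_of_ne_zero (ha n)
    have h2 := Real.log_le_log hpos h1.le
    rw [Real.log_rpow hP] at h2
    rw [quotientProduct_succ, Real.log_mul hP.ne' hpos.ne']
    linarith
  have hgeom : ∀ k,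
      Real.log (quotientProduct x (N + k)) ≤ c ^ k * Real.log (quotientProduct x N) := by
    intro k
    induction k with
    | zero => simp
    | succ k ih =>
      calc _ ≤ c * Real.log (quotientProduct x (N + k)) := hstep (N + k) (by omega)
        _ ≤ c * (c ^ k * Real.log (quotientProduct x N)) := by gcongr
        _ = _ := by ring
  have hτ : 0 ≤ ∑ i, t i := Finset.sum_nonneg fun i _ => ht i
  set D := (∑ i, t i) * (c ^ m * Real.log (quotientProduct x N)) with hD
  have hbound : ∀ n, N + 1 ≤ n → Real.log (weightedProduct t x n) ≤ D * c ^ n := by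
    intro n hn
    obtain ⟨k, rfl⟩ : ∃ k, n = N + k + 1 := ⟨n - N - 1, by omega⟩
    calc _ ≤ (∑ i, t i) * Real.log (quotientProduct x (N + k + 1 + m)) :=
          log_weightedProduct_le ht ha (N + k)
      _ = (∑ i, t i) * Real.log (quotientProduct x (N + (k + 1 + m))) := by
          rw [show N + k + 1 + m = N + (k + 1 + m) by ring]
      _ ≤ (∑ i, t i) * (c ^ (k + 1 + m) * Real.log (quotientProduct x N)) := by
          gcongr; exact hgeom _
      _ ≤ (∑ i, t i) * (c ^ (N + k + 1 + m) * Real.log (quotientProduct x N)) := by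
          have := hS N
          gcongr
          omega
      _ = _ := by rw [hD, pow_add]; ring
  have hlim := (tendsto_pow_atTop_atTop_of_one_lt ((one_lt_div (by linarith)).2 hcc')).eventually
    (eventually_gt_atTop D)
  obtain ⟨n, hn, hn1, hn2⟩ := (hW.and_eventually ((eventually_ge_atTop (N + 1)).and hlim)).exists
  have h1 := (Real.le_log_iff_exp_le ((Real.exp_pos _).trans_le hn)).2 hn
  rw [div_pow, lt_div_iff₀ (by positivity)] at hn2
  linarith [hbound n hn1]

lemma ND'_subset {m : ℕ} {t : Fin (m + 1) → ℝ} (ht : ∀ i, 0 ≤ t i) (ht0 : ∃ i, t i ≠ 0)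
    {φ : ℕ → ℝ} (hφ : Tendsto φ atTop atTop) {c : ℝ} (hc : 1 ≤ c)
    (h : c = 1 ∨ ∃ c' > c, ∃ᶠ n in atTop, Real.exp (c' ^ n) ≤ φ n) :
    ND' t φ ⊆ rapidGrowth c ∪ Set.range ((↑) : ℚ → ℝ) := by
  rintro x ⟨hx, hxW⟩
  by_cases hirr : Irrational x
  · left
    have ha := partialQuotient_ne_zero hx hirr
    refine ⟨hx, ha,
      eventually_pow_le_quotientProduct ht ht0 ha (tendsto_atTop_mono' _ hxW hφ), ?_⟩
    rcases h with rfl | ⟨c', hcc', hf⟩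
    · refine Frequently.of_forall fun n => ?_
      rw [sub_self, Real.rpow_zero]
      exact_mod_cast Nat.one_le_iff_ne_zero.2 (ha n)
    · exact frequently_le_partialQuotient ht ha hc hcc'
        ((hf.and_eventually hxW).mono fun n hn => hn.1.trans hn.2)
  · right
    exact not_not.1 hirr

lemma dimH_ND'_le {m : ℕ} {t : Fin (m + 1) → ℝ} (ht : ∀ i, 0 ≤ t i) (ht0 : ∃ i, t i ≠ 0)
    {φ : ℕ → ℝ} (hφ : Tendsto φ atTop atTop) {c : ℝ} (hc : 1 ≤ c)
    (h : c = 1 ∨ ∃ c' > c, ∃ᶠ n in atTop, Real.exp (c' ^ n) ≤ φ n) :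
    dimH (ND' t φ) ≤ ENNReal.ofReal (1 / (1 + c)) := by
  refine (dimH_mono (ND'_subset ht ht0 hφ hc h)).trans ?_
  rw [dimH_union, dimH_countable (Set.countable_range _)]
  refine max_le (ENNReal.le_of_forall_pos_le_add fun ε hε _ => ?_) zero_le
  have hs : 1 < (c + 1) * ((Real.toNNReal (1 / (1 + c)) + ε : NNReal) : ℝ) := by
    rw [NNReal.coe_add, Real.coe_toNNReal _ (by positivity)]
    have h1 : (c + 1) * (1 / (1 + c)) = 1 := by field_simp; ring
    have h2 : 0 < (c + 1) * (ε : ℝ) := mul_pos (by linarith) hε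
    linarith
  have := dimH_rapidGrowth_le hc hs
  rwa [ENNReal.coe_add] at this

/-! ### Points with prescribed partial quotients -/

/-- The finite continued fraction `1 / (a 0 + 1 / (a 1 + ⋯ + 1 / a (n - 1)))`. -/
noncomputable def cfApprox : ℕ → (ℕ → ℕ) → ℝ
  | 0, _ => 0
  | n + 1, a => 1 / (a 0 + cfApprox n (fun k => a (k + 1)))

lemma cfApprox_nonneg (n : ℕ) (a : ℕ → ℕ) : 0 ≤ cfApprox n a := by
  induction n generalizing a with
  | zero => exact le_rfl
  | succ n ih =>
    have := ih (fun k => a (k + 1))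
    rw [cfApprox]
    positivity

lemma cfApprox_le_half (n : ℕ) {a : ℕ → ℕ} (ha : ∀ k, 2 ≤ a k) : cfApprox n a ≤ 1 / 2 := by
  cases n with
  | zero => norm_num [cfApprox]
  | succ n =>
    have h : (2 : ℝ) ≤ a 0 := by exact_mod_cast ha 0
    rw [cfApprox]
    gcongr
    linarith [cfApprox_nonneg n (fun k => a (k + 1))]

lemma dist_cfApprox_le (n : ℕ) {a : ℕ → ℕ} (ha : ∀ k, 2 ≤ a k) :
    dist (cfApprox n a) (cfApprox (n + 1) a) ≤ 1 * (1 / 4) ^ n := by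
  induction n generalizing a with
  | zero =>
    rw [Real.dist_eq, abs_sub_comm]
    have h1 := cfApprox_nonneg 1 a
    have h2 := cfApprox_le_half 1 ha
    rw [show cfApprox 0 a = 0 from rfl, zero_add, sub_zero, abs_of_nonneg h1]
    linarith
  | succ n ih =>
    have ih' := ih (a := fun k => a (k + 1)) (fun k => ha _)
    rw [Real.dist_eq] at ih' ⊢
    rw [cfApprox, cfApprox.eq_def (n + 1 + 1)]
    have h0 : (2 : ℝ) ≤ a 0 := by exact_mod_cast ha 0
    have hu := cfApprox_nonneg n (fun k => a (k + 1))
    have hv := cfApprox_nonneg (n + 1) (fun k => a (k + 1))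
    simp only at *
    set u := cfApprox n (fun k => a (k + 1))
    set v := cfApprox (n + 1) (fun k => a (k + 1))
    have e : 1 / ((a 0 : ℝ) + u) - 1 / (a 0 + v) = (v - u) / ((a 0 + u) * (a 0 + v)) := by
      field_simp
      ring
    rw [e, abs_div, abs_of_pos (by positivity : 0 < ((a 0 : ℝ) + u) * (a 0 + v)), abs_sub_comm v]
    have h4 : (2 * 2 : ℝ) ≤ (a 0 + u) * (a 0 + v) := by gcongr <;> linarith
    calc _ ≤ |u - v| / (2 * 2) := by gcongr
      _ ≤ 1 * (1 / 4) ^ n / (2 * 2) := by gcongr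
      _ = _ := by ring

/-- The value of the infinite continued fraction with partial quotients `a 0, a 1, …`. The limit
exists when all of them are at least `2`. -/
noncomputable def cfValue (a : ℕ → ℕ) : ℝ := limUnder atTop fun n => cfApprox n a

lemma tendsto_cfApprox {a : ℕ → ℕ} (ha : ∀ k, 2 ≤ a k) :
    Tendsto (fun n => cfApprox n a) atTop (𝓝 (cfValue a)) :=
  (cauchySeq_of_le_geometric (1 / 4) 1 (by norm_num) fun n => dist_cfApprox_le n ha).tendsto_limUnder

lemma cfValue_nonneg {a : ℕ → ℕ} (ha : ∀ k, 2 ≤ a k) : 0 ≤ cfValue a :=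
  ge_of_tendsto' (tendsto_cfApprox ha) fun n => cfApprox_nonneg n a

lemma cfValue_le_half {a : ℕ → ℕ} (ha : ∀ k, 2 ≤ a k) : cfValue a ≤ 1 / 2 :=
  le_of_tendsto' (tendsto_cfApprox ha) fun n => cfApprox_le_half n ha

lemma one_div_cfValue {a : ℕ → ℕ} (ha : ∀ k, 2 ≤ a k) :
    1 / cfValue a = a 0 + cfValue (fun k => a (k + 1)) := by
  have h0 : (2 : ℝ) ≤ a 0 := by exact_mod_cast ha 0
  have hv := cfValue_nonneg (a := fun k => a (k + 1)) (fun k => ha _)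
  have h1 := (tendsto_const_nhds (x := (1 : ℝ))).div
    ((tendsto_const_nhds (x := (a 0 : ℝ))).add (tendsto_cfApprox (a := fun k => a (k + 1))
      (fun k => ha _))) (by positivity)
  have h2 := (tendsto_add_atTop_iff_nat 1).2 (tendsto_cfApprox ha)
  rw [tendsto_nhds_unique h2 h1, one_div_one_div]

lemma gaussMap_cfValue {a : ℕ → ℕ} (ha : ∀ k, 2 ≤ a k) :
    gaussMap (cfValue a) = cfValue (fun k => a (k + 1)) := by
  have h1 := cfValue_nonneg (a := fun k => a (k + 1)) (fun k => ha _)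
  have h2 := cfValue_le_half (a := fun k => a (k + 1)) (fun k => ha _)
  rw [gaussMap, one_div_cfValue ha, Int.fract_natCast_add, Int.fract_eq_self]
  exact ⟨h1, by linarith⟩

lemma gaussMap_iterate_cfValue (n : ℕ) {a : ℕ → ℕ} (ha : ∀ k, 2 ≤ a k) :
    gaussMap^[n] (cfValue a) = cfValue (fun k => a (k + n)) := by
  induction n with
  | zero => rfl
  | succ n ih =>
    rw [Function.iterate_succ_apply', ih, gaussMap_cfValue fun k => ha _]
    simp only [Nat.add_right_comm, Nat.add_assoc]

lemma partialQuotient_cfValue (n : ℕ) {a : ℕ → ℕ} (ha : ∀ k, 2 ≤ a k) :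
    partialQuotient (cfValue a) (n + 1) = a n := by
  have h1 := cfValue_nonneg (a := fun k => a (k + 1 + n)) (fun k => ha _)
  have h2 := cfValue_le_half (a := fun k => a (k + 1 + n)) (fun k => ha _)
  rw [partialQuotient_succ, gaussMap_iterate_cfValue n ha, one_div_cfValue fun k => ha _,
    add_comm, Nat.floor_add_natCast h1, Nat.floor_eq_zero.2 (by linarith)]
  simp

/-! ### Mixed radix expansions -/

/-- The `n`-th remainder of `y` in the mixed radix expansion with bases `u 0, u 1, …`. -/
noncomputable def radixTail (u : ℕ → ℕ) : ℕ → ℝ → ℝ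
  | 0, y => y
  | n + 1, y => Int.fract (u n * radixTail u n y)

/-- The `n`-th digit, in `{0, …, u n - 1}`, of `y ∈ [0, 1)` in the mixed radix expansion with bases
`u 0, u 1, …`. -/
noncomputable def radixDigit (u : ℕ → ℕ) (n : ℕ) (y : ℝ) : ℕ := ⌊u n * radixTail u n y⌋₊

lemma radixTail_mem (u : ℕ → ℕ) {y : ℝ} (hy : y ∈ Set.Ico (0 : ℝ) 1) (n : ℕ) :
    radixTail u n y ∈ Set.Ico (0 : ℝ) 1 := by
  cases n with
  | zero => exact hy
  | succ n => exact ⟨Int.fract_nonneg _, Int.fract_lt_one _⟩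

lemma mul_radixTail (u : ℕ → ℕ) {y : ℝ} (hy : y ∈ Set.Ico (0 : ℝ) 1) (n : ℕ) :
    u n * radixTail u n y = radixDigit u n y + radixTail u (n + 1) y := by
  have h := (radixTail_mem u hy n).1
  rw [radixDigit, radixTail, natCast_floor_eq_intCast_floor (by positivity)]
  exact (Int.floor_add_fract _).symm

lemma radixDigit_lt {u : ℕ → ℕ} (hu : ∀ n, 2 ≤ u n) {y : ℝ} (hy : y ∈ Set.Ico (0 : ℝ) 1) (n : ℕ) :
    radixDigit u n y < u n := by
  have h := radixTail_mem u hy n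
  have h0 : (0 : ℝ) < u n := by have := hu n; positivity
  rw [radixDigit, Nat.floor_lt (by have := h.1; positivity)]
  nlinarith [h.2]

lemma abs_sub_eq_of_radixDigit_eq {u : ℕ → ℕ} (hu : ∀ n, 2 ≤ u n) {y z : ℝ}
    (hy : y ∈ Set.Ico (0 : ℝ) 1) (hz : z ∈ Set.Ico (0 : ℝ) 1) (n : ℕ)
    (h : ∀ i < n, radixDigit u i y = radixDigit u i z) :
    |y - z| = |radixTail u n y - radixTail u n z| / ∏ i ∈ Finset.range n, (u i : ℝ) := by
  induction n with
  | zero => simp [radixTail]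
  | succ n ih =>
    have h0 : (0 : ℝ) < u n := by have := hu n; positivity
    have e : radixTail u (n + 1) y - radixTail u (n + 1) z =
        u n * (radixTail u n y - radixTail u n z) := by
      rw [mul_sub, mul_radixTail u hy, mul_radixTail u hz, h n (by omega)]
      ring
    rw [ih fun i hi => h i (by omega), Finset.prod_range_succ, e, abs_mul, abs_of_pos h0]
    field_simp

lemma exists_radixDigit_ne {u : ℕ → ℕ} (hu : ∀ n, 2 ≤ u n) {y z : ℝ}
    (hy : y ∈ Set.Ico (0 : ℝ) 1) (hz : z ∈ Set.Ico (0 : ℝ) 1) (hyz : y ≠ z) :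
    ∃ n, radixDigit u n y ≠ radixDigit u n z := by
  by_contra! h
  obtain ⟨n, hn⟩ := exists_pow_lt_of_lt_one (abs_pos.2 (sub_ne_zero.2 hyz))
    (by norm_num : (1 / 2 : ℝ) < 1)
  have h1 := radixTail_mem u hy n
  have h2 := radixTail_mem u hz n
  have h3 : |radixTail u n y - radixTail u n z| ≤ 1 := by
    rw [abs_le]; constructor <;> linarith [h1.1, h1.2, h2.1, h2.2]
  have h4 : (2 : ℝ) ^ n ≤ ∏ i ∈ Finset.range n, (u i : ℝ) := by
    simpa using Finset.prod_le_prod (s := Finset.range n) (f := fun _ => (2 : ℝ))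
      (g := fun i => (u i : ℝ)) (fun _ _ => by norm_num) (fun i _ => by exact_mod_cast hu i)
  rw [abs_sub_eq_of_radixDigit_eq hu hy hz n fun i _ => h i] at hn
  refine absurd hn (not_lt.2 ?_)
  rw [one_div, inv_pow, ← one_div]
  gcongr

/-! ### A large set of points with large partial quotients -/

/-- The point whose partial quotients are `u n` plus the mixed radix digits of `y`. -/
noncomputable def radixPoint (u : ℕ → ℕ) (y : ℝ) : ℝ := cfValue fun n => u n + radixDigit u n y

lemma partialQuotient_radixPoint {u : ℕ → ℕ} (hu : ∀ n, 2 ≤ u n) (y : ℝ) (n : ℕ) :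
    partialQuotient (radixPoint u y) (n + 1) = u n + radixDigit u n y :=
  partialQuotient_cfValue n fun k => (hu k).trans (Nat.le_add_right _ _)

lemma gaussMap_iterate_radixPoint_mem {u : ℕ → ℕ} (hu : ∀ n, 2 ≤ u n) (y : ℝ) (n : ℕ) :
    gaussMap^[n] (radixPoint u y) ∈ Set.Icc (0 : ℝ) (1 / 2) := by
  have h : ∀ k, 2 ≤ u k + radixDigit u k y := fun k => (hu k).trans (Nat.le_add_right _ _)
  rw [radixPoint, gaussMap_iterate_cfValue n h]
  exact ⟨cfValue_nonneg fun k => h _, cfValue_le_half fun k => h _⟩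

/-- Two points of the construction whose expansions first differ at index `n`, by `Δ`, are at
distance at least `Δ / (8 · 4 ^ n · (u 0 ⋯ u n)²)`: the later partial quotients are at least `2`,
which separates neighbouring cylinders. -/
lemma le_abs_radixPoint_sub {u : ℕ → ℕ} (hu : ∀ n, 2 ≤ u n) {y z : ℝ}
    (hy : y ∈ Set.Ico (0 : ℝ) 1) (hz : z ∈ Set.Ico (0 : ℝ) 1) (n : ℕ)
    (h : ∀ i < n, radixDigit u i y = radixDigit u i z)
    (hne : radixDigit u n y ≠ radixDigit u n z) :
    |(radixDigit u n y : ℝ) - radixDigit u n z| /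
      (8 * 4 ^ n * ((∏ i ∈ Finset.range n, (u i : ℝ)) * u n) ^ 2) ≤
        |radixPoint u y - radixPoint u z| := by
  have hay : ∀ i, partialQuotient (radixPoint u y) (i + 1) ≠ 0 := fun i => by
    rw [partialQuotient_radixPoint hu]; have := hu i; omega
  have haz : ∀ i, partialQuotient (radixPoint u z) (i + 1) ≠ 0 := fun i => by
    rw [partialQuotient_radixPoint hu]; have := hu i; omega
  have hup : ∀ i, (0 : ℝ) < u i := fun i => by have := hu i; positivity
  have hlow := le_abs_sub_of_partialQuotient_eq n (x := radixPoint u y) (y := radixPoint u z)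
    (gaussMap_iterate_radixPoint_mem hu y 0).1 (gaussMap_iterate_radixPoint_mem hu z 0).1 hay haz
    (fun i hi => by
      rw [partialQuotient_radixPoint hu, partialQuotient_radixPoint hu, h i hi])
  refine le_trans ?_ hlow
  have hgy := gaussMap_iterate_radixPoint_mem hu y n
  have hgz := gaussMap_iterate_radixPoint_mem hu z n
  have hgy' := gaussMap_iterate_radixPoint_mem hu y (n + 1)
  have hgz' := gaussMap_iterate_radixPoint_mem hu z (n + 1)
  rw [Function.iterate_succ_apply'] at hgy' hgz'
  rw [abs_sub_eq_of_partialQuotient hgy.1 hgz.1 (hay n) (haz n), ← partialQuotient_iterate,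
    ← partialQuotient_iterate, partialQuotient_radixPoint hu, partialQuotient_radixPoint hu]
  have hdig : ∀ {w : ℝ}, w ∈ Set.Ico (0 : ℝ) 1 → ∀ i,
      ((u i + radixDigit u i w : ℕ) : ℝ) + 1 ≤ 2 * u i := fun hw i => by
    have := radixDigit_lt hu hw i
    exact_mod_cast (by omega : u i + radixDigit u i _ + 1 ≤ 2 * u i)
  have hprod : ∏ i ∈ Finset.range n, ((partialQuotient (radixPoint u y) (i + 1) : ℝ) + 1) ≤
      2 ^ n * ∏ i ∈ Finset.range n, (u i : ℝ) := by
    calc _ ≤ ∏ i ∈ Finset.range n, (2 * (u i : ℝ)) := by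
          refine Finset.prod_le_prod (fun i _ => by positivity) fun i _ => ?_
          rw [partialQuotient_radixPoint hu]
          exact hdig hy i
      _ = _ := by rw [Finset.prod_mul_distrib]; simp
  have hΔ : 1 ≤ |(radixDigit u n y : ℝ) - radixDigit u n z| := by
    have h1 : (1 : ℤ) ≤ |(radixDigit u n y : ℤ) - radixDigit u n z| :=
      Int.one_le_abs (sub_ne_zero.2 (by exact_mod_cast hne))
    exact_mod_cast h1
  have hU : 0 < ∏ i ∈ Finset.range n, (u i : ℝ) := Finset.prod_pos fun i _ => hup i
  have hQ : 0 < ∏ i ∈ Finset.range n, ((partialQuotient (radixPoint u y) (i + 1) : ℝ) + 1) :=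
    Finset.prod_pos fun i _ => by positivity
  set U := ∏ i ∈ Finset.range n, (u i : ℝ)
  set Q := ∏ i ∈ Finset.range n, ((partialQuotient (radixPoint u y) (i + 1) : ℝ) + 1)
  set gy := gaussMap (gaussMap^[n] (radixPoint u y))
  set gz := gaussMap (gaussMap^[n] (radixPoint u z))
  have hdy := hdig hy n
  have hdz := hdig hz n
  have hupn := hup n
  push_cast at hdy hdz ⊢
  set dy := (radixDigit u n y : ℝ)
  set dz := (radixDigit u n z : ℝ)
  have hdy0 : 0 ≤ dy := by positivity
  have hdz0 : 0 ≤ dz := by positivity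
  have hnum : |dy - dz| / 2 ≤ |(u n + dy + gy) - (u n + dz + gz)| := by
    have e : (u n + dy + gy) - (u n + dz + gz) = (dy - dz) - (gz - gy) := by ring
    have h1 := abs_sub_abs_le_abs_sub (dy - dz) (gz - gy)
    have h2 : |gz - gy| ≤ 1 / 2 := by
      rw [abs_le]; constructor <;> linarith [hgy'.1, hgy'.2, hgz'.1, hgz'.2]
    rw [e]
    linarith
  calc |dy - dz| / (8 * 4 ^ n * (U * u n) ^ 2)
      = |dy - dz| / 2 / ((2 * u n) * (2 * u n)) / (2 ^ n * U) ^ 2 := by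
        rw [show (4 : ℝ) ^ n = 2 ^ n * 2 ^ n by rw [← mul_pow]; norm_num]
        field_simp
        ring
    _ ≤ |(u n + dy + gy) - (u n + dz + gz)| /
          ((u n + dy + gy) * (u n + dz + gz)) / Q ^ 2 := by
        have hgy0 := hgy'.1
        have hgz0 := hgz'.1
        have h1 : u n + dy + gy ≤ 2 * u n := by linarith [hgy'.2]
        have h2 : u n + dz + gz ≤ 2 * u n := by linarith [hgz'.2]
        gcongr

lemma abs_sub_le_of_radixDigit {u : ℕ → ℕ} (hu : ∀ n, 2 ≤ u n) {y z : ℝ}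
    (hy : y ∈ Set.Ico (0 : ℝ) 1) (hz : z ∈ Set.Ico (0 : ℝ) 1) (n : ℕ)
    (h : ∀ i < n, radixDigit u i y = radixDigit u i z)
    (hne : radixDigit u n y ≠ radixDigit u n z) :
    |y - z| ≤ 2 * (|(radixDigit u n y : ℝ) - radixDigit u n z| / u n) /
      ∏ i ∈ Finset.range n, (u i : ℝ) := by
  have hup : (0 : ℝ) < u n := by have := hu n; positivity
  have hU : 0 < ∏ i ∈ Finset.range n, (u i : ℝ) :=
    Finset.prod_pos fun i _ => by have := hu i; positivity
  rw [abs_sub_eq_of_radixDigit_eq hu hy hz n h]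
  gcongr
  have hΔ : 1 ≤ |(radixDigit u n y : ℝ) - radixDigit u n z| := by
    have h1 : (1 : ℤ) ≤ |(radixDigit u n y : ℤ) - radixDigit u n z| :=
      Int.one_le_abs (sub_ne_zero.2 (by exact_mod_cast hne))
    exact_mod_cast h1
  rw [← mul_div_assoc, le_div_iff₀ hup, ← abs_of_pos hup, ← abs_mul, mul_comm,
    mul_sub, mul_radixTail u hy, mul_radixTail u hz]
  have h1 := radixTail_mem u hy (n + 1)
  have h2 := radixTail_mem u hz (n + 1)
  have h3 : |radixTail u (n + 1) y - radixTail u (n + 1) z| ≤ 1 := by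
    rw [abs_le]; constructor <;> linarith [h1.1, h1.2, h2.1, h2.2]
  rw [add_sub_add_comm]
  linarith [abs_add_le ((radixDigit u n y : ℝ) - radixDigit u n z)
    (radixTail u (n + 1) y - radixTail u (n + 1) z)]

/-- The inverse of `radixPoint u` is Hölder continuous. -/
lemma abs_sub_le_abs_radixPoint_sub_rpow {u : ℕ → ℕ} (hu : ∀ n, 2 ≤ u n) {s C : ℝ} (hs : 0 < s)
    (hs1 : s ≤ 1)
    (hC : ∀ n, (8 * 4 ^ n * (∏ i ∈ Finset.range n, (u i : ℝ)) ^ 2 * u n) ^ s ≤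
      C * ∏ i ∈ Finset.range n, (u i : ℝ)) {y z : ℝ}
    (hy : y ∈ Set.Ico (0 : ℝ) 1) (hz : z ∈ Set.Ico (0 : ℝ) 1) (hyz : y ≠ z) :
    |y - z| ≤ 2 * C * |radixPoint u y - radixPoint u z| ^ s := by
  classical
  have hex := exists_radixDigit_ne hu hy hz hyz
  set n := Nat.find hex
  have hne : radixDigit u n y ≠ radixDigit u n z := Nat.find_spec hex
  have heq : ∀ i < n, radixDigit u i y = radixDigit u i z :=
    fun i hi => not_not.1 (Nat.find_min hex hi)
  have h1 := abs_sub_le_of_radixDigit hu hy hz n heq hne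
  have h2 := le_abs_radixPoint_sub hu hy hz n heq hne
  have hCn := hC n
  have hup : (0 : ℝ) < u n := by have := hu n; positivity
  have hU : 0 < ∏ i ∈ Finset.range n, (u i : ℝ) :=
    Finset.prod_pos fun i _ => by have := hu i; positivity
  set U := ∏ i ∈ Finset.range n, (u i : ℝ)
  set q := |(radixDigit u n y : ℝ) - radixDigit u n z| / u n with hq
  have hq0 : 0 ≤ q := by positivity
  have hq1 : q ≤ 1 := by
    rw [hq, div_le_one hup, abs_le]
    have hdy : (radixDigit u n y : ℝ) < u n := by exact_mod_cast radixDigit_lt hu hy n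
    have hdz : (radixDigit u n z : ℝ) < u n := by exact_mod_cast radixDigit_lt hu hz n
    have hy0 : (0 : ℝ) ≤ radixDigit u n y := by positivity
    have hz0 : (0 : ℝ) ≤ radixDigit u n z := by positivity
    constructor <;> linarith
  have hqs : q ≤ q ^ s := Real.self_le_rpow_of_le_one hq0 hq1 hs1
  set X := 8 * 4 ^ n * U ^ 2 * u n with hX
  have hXpos : 0 < X := by positivity
  have hXs : 0 < X ^ s := Real.rpow_pos_of_pos hXpos s
  have hC0 : 0 < C := pos_of_mul_pos_left (hXs.trans_le hCn) hU.le
  have h3 : q / X ≤ |radixPoint u y - radixPoint u z| := by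
    refine le_trans (le_of_eq ?_) h2
    rw [hq, hX, div_div]
    congr 1
    ring
  calc |y - z| ≤ 2 * q / U := h1
    _ ≤ 2 * q ^ s / U := by gcongr
    _ ≤ 2 * q ^ s * (C / X ^ s) := by
        rw [div_eq_mul_inv]
        gcongr
        rw [inv_eq_one_div, div_le_div_iff₀ hU hXs]
        linarith
    _ = 2 * C * (q / X) ^ s := by rw [Real.div_rpow hq0 hXpos.le]; ring
    _ ≤ _ := by gcongr

/-- The inverse of `radixPoint u` maps onto `[0, 1)`, a set of dimension `1`, so that its Hölder
exponent bounds the dimension of its domain from below. -/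
lemma le_dimH_of_radix {u : ℕ → ℕ} (hu : ∀ n, 2 ≤ u n) {s : NNReal} {C : ℝ} (hs : 0 < s)
    (hs1 : s ≤ 1)
    (hC : ∀ n, (8 * 4 ^ n * (∏ i ∈ Finset.range n, (u i : ℝ)) ^ 2 * u n) ^ (s : ℝ) ≤
      C * ∏ i ∈ Finset.range n, (u i : ℝ)) :
    (s : ENNReal) ≤ dimH {x | x ∈ Set.Ico (0 : ℝ) 1 ∧ ∀ n, u n ≤ partialQuotient x (n + 1)} := by
  have hC0 : 0 ≤ C := by
    have h := hC 0
    simp only [Finset.range_zero, Finset.prod_empty, mul_one] at h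
    exact le_trans (by positivity) h
  have hmain : ∀ y ∈ Set.Ico (0 : ℝ) 1, ∀ z ∈ Set.Ico (0 : ℝ) 1,
      |y - z| ≤ 2 * C * |radixPoint u y - radixPoint u z| ^ (s : ℝ) := by
    intro y hy z hz
    by_cases hyz : y = z
    · rw [hyz, sub_self, abs_zero]; positivity
    · exact abs_sub_le_abs_radixPoint_sub_rpow hu (by exact_mod_cast hs) (by exact_mod_cast hs1)
        hC hy hz hyz
  have hinj : Set.InjOn (radixPoint u) (Set.Ico 0 1) := by
    intro y hy z hz h
    have := hmain y hy z hz
    rw [h, sub_self, abs_zero, Real.zero_rpow (by exact_mod_cast hs.ne'), mul_zero] at this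
    exact sub_eq_zero.1 (abs_nonpos_iff.1 this)
  have hinv := hinj.leftInvOn_invFunOn
  have hHolder : HolderOnWith (2 * C).toNNReal s (Function.invFunOn (radixPoint u) (Set.Ico 0 1))
      (radixPoint u '' Set.Ico 0 1) := by
    rintro _ ⟨y, hy, rfl⟩ _ ⟨z, hz, rfl⟩
    rw [hinv hy, hinv hz, edist_dist, edist_dist,
      ENNReal.ofReal_rpow_of_nonneg dist_nonneg s.coe_nonneg]
    change _ ≤ ENNReal.ofReal (2 * C) * _
    rw [← ENNReal.ofReal_mul (by positivity)]
    exact ENNReal.ofReal_le_ofReal (hmain y hy z hz)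
  have h1 := hHolder.dimH_image_le hs
  rw [hinv.image_image, Real.dimH_of_nonempty_interior (by simp),
    ENNReal.le_div_iff_mul_le (Or.inl (by exact_mod_cast hs.ne')) (Or.inl ENNReal.coe_ne_top)] at h1
  simp only [Module.finrank_self, Nat.cast_one, one_mul] at h1
  refine h1.trans (dimH_mono ?_)
  rintro _ ⟨y, _, rfl⟩
  have h2 := gaussMap_iterate_radixPoint_mem hu y 0
  refine ⟨⟨h2.1, lt_of_le_of_lt h2.2 (by norm_num)⟩, fun n => ?_⟩
  rw [partialQuotient_radixPoint hu]
  exact Nat.le_add_right _ _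

/-! ### Doubly exponential lower bounds on the partial quotients -/

/-- The choice `u n = ⌈exp (κ B ^ n)⌉` with `κ` large: the exponents of `u 0 ⋯ u (n - 1)` and `u n`
are asymptotically in the ratio `1 / (B - 1)`, which makes `1 / (1 + B)` the critical exponent. -/
lemma exists_radix_bases {B s : ℝ} (hB : 1 < B) (hs : 0 < s) (hsB : s * (1 + B) < 1) (M : ℝ) :
    ∃ u : ℕ → ℕ, (∀ n, 2 ≤ u n) ∧ (∀ n, Real.exp (M * B ^ n) ≤ u n) ∧
      ∃ C : ℝ, ∀ n, (8 * 4 ^ n * (∏ i ∈ Finset.range n, (u i : ℝ)) ^ 2 * u n) ^ s ≤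
        C * ∏ i ∈ Finset.range n, (u i : ℝ) := by
  have hB0 : 0 < B - 1 := by linarith
  -- `η` is the surplus of the coefficient of `κ B ^ n` in `(1 - 2 s) log (u 0 ⋯ u (n - 1))` over
  -- that in `s log (u n)`; it pays for the factor `4 ^ n`.
  obtain ⟨η, hη⟩ : ∃ η, η = (1 - 2 * s) / (B - 1) - s := ⟨_, rfl⟩
  have hη0 : 0 < η := by
    rw [hη, sub_pos, lt_div_iff₀ hB0]
    linarith
  obtain ⟨κ, hκ1, hκM, hκη⟩ : ∃ κ : ℝ, 1 ≤ κ ∧ M ≤ κ ∧ s * Real.log 4 / (η * (B - 1)) ≤ κ :=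
    ⟨max 1 (max M (s * Real.log 4 / (η * (B - 1)))), le_max_left _ _,
      (le_max_left _ _).trans (le_max_right _ _), (le_max_right _ _).trans (le_max_right _ _)⟩
  have hBn : ∀ n : ℕ, 1 ≤ B ^ n := fun n => one_le_pow₀ hB.le
  have hκB : ∀ n, 1 ≤ κ * B ^ n := fun n => by nlinarith [hBn n]
  have hexp : ∀ n, 2 ≤ Real.exp (κ * B ^ n) := fun n => by
    linarith [Real.add_one_le_exp (κ * B ^ n), hκB n]
  let u : ℕ → ℕ := fun n => ⌈Real.exp (κ * B ^ n)⌉₊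
  have hlow : ∀ n, Real.exp (κ * B ^ n) ≤ u n := fun n => Nat.le_ceil _
  have hup : ∀ n, (u n : ℝ) ≤ 2 * Real.exp (κ * B ^ n) := fun n => by
    have := Nat.ceil_lt_add_one (Real.exp_pos (κ * B ^ n)).le
    linarith [hexp n]
  have hupos : ∀ n, (0 : ℝ) < u n := fun n => (Real.exp_pos _).trans_le (hlow n)
  refine ⟨u, fun n => by exact_mod_cast (hexp n).trans (hlow n), fun n => ?_,
    Real.exp (s * Real.log 16 + (1 - 2 * s) * κ / (B - 1)), fun n => ?_⟩
  · refine le_trans (Real.exp_le_exp.2 ?_) (hlow n)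
    have := hBn n
    gcongr
  have hU : 0 < ∏ i ∈ Finset.range n, (u i : ℝ) := Finset.prod_pos fun i _ => hupos i
  have hlogU : κ * (B ^ n - 1) / (B - 1) ≤ Real.log (∏ i ∈ Finset.range n, (u i : ℝ)) := by
    rw [Real.log_prod fun i _ => (hupos i).ne', mul_div_assoc, ← geom_sum_eq hB.ne',
      Finset.mul_sum]
    exact Finset.sum_le_sum fun i _ => (Real.le_log_iff_exp_le (hupos i)).2 (hlow i)
  have hlogu : Real.log (u n) ≤ Real.log 2 + κ * B ^ n := by
    have := Real.log_le_log (hupos n) (hup n)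
    rwa [Real.log_mul (by norm_num) (Real.exp_pos _).ne', Real.log_exp] at this
  have hun := hupos n
  set U := ∏ i ∈ Finset.range n, (u i : ℝ)
  rw [← Real.log_le_log_iff (by positivity) (by positivity), Real.log_rpow (by positivity),
    Real.log_mul (by positivity) (by positivity), Real.log_mul (by positivity) (by positivity),
    Real.log_mul (by positivity) (by positivity), Real.log_pow, Real.log_pow,
    Real.log_mul (by positivity) (by positivity), Real.log_exp]
  push_cast
  have h16 : Real.log 16 = Real.log 8 + Real.log 2 := by
    rw [← Real.log_mul (by norm_num) (by norm_num)]; norm_num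
  have hbern : 1 + n * (B - 1) ≤ B ^ n := one_add_mul_sub_le_pow (by linarith) n
  have hs2 : 0 < 1 - 2 * s := by nlinarith
  have h1 : (1 - 2 * s) * (κ * (B ^ n - 1) / (B - 1)) ≤ (1 - 2 * s) * Real.log U :=
    mul_le_mul_of_nonneg_left hlogU hs2.le
  have h2 : s * Real.log (u n) ≤ s * (Real.log 2 + κ * B ^ n) :=
    mul_le_mul_of_nonneg_left hlogu hs.le
  have h3 : (1 - 2 * s) * (κ * (B ^ n - 1) / (B - 1)) =
      (η + s) * (κ * B ^ n) - (1 - 2 * s) * κ / (B - 1) := by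
    rw [hη]; field_simp; ring
  have h4 : s * (n * Real.log 4) ≤ η * (κ * B ^ n) := by
    rw [div_le_iff₀ (by positivity)] at hκη
    calc s * (n * Real.log 4) = n * (s * Real.log 4) := by ring
      _ ≤ n * (κ * (η * (B - 1))) := by gcongr
      _ = η * (κ * (n * (B - 1))) := by ring
      _ ≤ η * (κ * B ^ n) := by gcongr; linarith
  rw [h16]
  linarith

/-- A single partial quotient with positive weight makes the weighted product large; the factor
`B / t i` in the hypothesis compensates for the weight and for the index starting at `1`. -/
lemma le_weightedProduct {m : ℕ} {t : Fin (m + 1) → ℝ} (ht : ∀ i, 0 ≤ t i)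
    {i : Fin (m + 1)} (hi : 0 < t i) {B K x : ℝ} (hB : 1 ≤ B) (hK : 0 ≤ K)
    (ha : ∀ n, partialQuotient x (n + 1) ≠ 0)
    (hx : ∀ n, Real.exp (K * B / t i * B ^ n) ≤ partialQuotient x (n + 1)) (n : ℕ) :
    Real.exp (K * B ^ (n + 1)) ≤ weightedProduct t x (n + 1) := by
  have hW := one_le_weightedProduct ht ha n
  rw [← Real.le_log_iff_exp_le (by linarith), log_weightedProduct t ha]
  have h1 := Finset.single_le_sum
    (f := fun j : Fin (m + 1) => t j * Real.log (partialQuotient x (j + n + 1)))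
    (fun j _ => mul_nonneg (ht j) (Real.log_natCast_nonneg _)) (Finset.mem_univ i)
  refine le_trans ?_ h1
  have hpos : (0 : ℝ) < partialQuotient x (i + n + 1) := by
    exact_mod_cast Nat.pos_of_ne_zero (ha _)
  have h2 := (Real.le_log_iff_exp_le hpos).2 (hx (i + n))
  calc K * B ^ (n + 1) = t i * (K * B / t i * B ^ n) := by field_simp; ring
    _ ≤ t i * (K * B / t i * B ^ (i + n)) := by
        gcongr
        omega
    _ ≤ _ := mul_le_mul_of_nonneg_left h2 hi.le

lemma le_dimH_ND {m : ℕ} {t : Fin (m + 1) → ℝ} (ht : ∀ i, 0 ≤ t i) (ht0 : ∃ i, t i ≠ 0)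
    {φ : ℕ → ℝ} {B : ℝ} (hB : 1 < B) (hφ : ∀ᶠ n in atTop, φ n ≤ Real.exp (B ^ n)) :
    ENNReal.ofReal (1 / (1 + B)) ≤ dimH (ND t φ) := by
  obtain ⟨i, hi⟩ := ht0
  have hti : 0 < t i := lt_of_le_of_ne (ht i) hi.symm
  obtain ⟨N, hN⟩ := eventually_atTop.1 hφ
  have hS : 0 ≤ ∑ n ∈ Finset.range N, |φ n| := Finset.sum_nonneg fun n _ => abs_nonneg _
  -- The constant `K` takes care of the finitely many `n` below `N`.
  set K := 1 + ∑ n ∈ Finset.range N, |φ n| with hKdef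
  have hK : ∀ n, φ n ≤ Real.exp (K * B ^ n) := by
    intro n
    have hBn : 1 ≤ B ^ n := one_le_pow₀ hB.le
    rcases le_or_gt N n with h | h
    · refine (hN n h).trans (Real.exp_le_exp.2 ?_)
      nlinarith
    · have h1 := Finset.single_le_sum (f := fun n => |φ n|) (fun n _ => abs_nonneg _)
        (Finset.mem_range.2 h)
      have h2 := Real.add_one_le_exp (K * B ^ n)
      have h3 : K ≤ K * B ^ n := le_mul_of_one_le_right (by linarith) hBn
      linarith [le_abs_self (φ n)]
  refine le_of_forall_lt_imp_le_of_dense fun a ha => ?_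
  lift a to NNReal using ha.ne_top
  rcases eq_or_ne a 0 with rfl | ha0
  · simp
  have ha' : (a : ℝ) < 1 / (1 + B) := by
    rwa [← ENNReal.ofReal_coe_nnreal, ENNReal.ofReal_lt_ofReal_iff (by positivity)] at ha
  rw [lt_div_iff₀ (by linarith)] at ha'
  have hapos : (0 : ℝ) < a := by positivity
  obtain ⟨u, hu, huM, C, hC⟩ := exists_radix_bases hB hapos ha' (K * B / t i)
  refine (le_dimH_of_radix hu (pos_iff_ne_zero.2 ha0) ?_ hC).trans (dimH_mono ?_)
  · have : (a : ℝ) ≤ 1 := by nlinarith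
    exact_mod_cast this
  · rintro x ⟨hx, hxu⟩
    refine ⟨hx, fun n hn => ?_⟩
    obtain ⟨k, rfl⟩ : ∃ k, n = k + 1 := ⟨n - 1, by omega⟩
    refine (hK (k + 1)).trans (le_weightedProduct ht hti hB.le (by linarith) (fun n => ?_)
      (fun n => ?_) k)
    · have := hu n
      have := hxu n
      omega
    · exact (huM n).trans (by exact_mod_cast hxu n)

/-! ### The order of growth -/

/-- As `φ` tends to infinity, `log (log (φ n))` is eventually nonnegative. -/
lemma one_le_of_log_eq_limsup {φ : ℕ → ℝ} (hφ : Tendsto φ atTop atTop) {A : ENNReal}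
    (hA : ENNReal.log A =
      limsup (fun n : ℕ => ((Real.log (Real.log (φ n)) / (n : ℝ) : ℝ) : EReal)) atTop) :
    1 ≤ A := by
  by_contra! h
  have h1 : ENNReal.log A < 0 := by rw [← ENNReal.log_one]; exact ENNReal.log_strictMono h
  rw [hA] at h1
  have hlog := (Real.tendsto_log_atTop.comp (Real.tendsto_log_atTop.comp hφ)).eventually_ge_atTop 0
  obtain ⟨n, hn, hn'⟩ := ((eventually_lt_of_limsup_lt h1).and hlog).exists
  have h2 : Real.log (Real.log (φ n)) / (n : ℝ) < 0 := by exact_mod_cast hn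
  exact absurd h2 (not_lt.2 (div_nonneg hn' (Nat.cast_nonneg n)))

lemma log_ofReal_eq {B : ℝ} (hB : 0 < B) :
    ENNReal.log (ENNReal.ofReal B) = (Real.log B : EReal) := by
  rw [ENNReal.log_pos_real' (by rwa [ENNReal.toReal_ofReal hB.le]), ENNReal.toReal_ofReal hB.le]

lemma log_log_div_lt_iff {φ : ℝ} (hφ : 1 < φ) {B : ℝ} (hB : 0 < B) {n : ℕ} (hn : 0 < n) :
    Real.log (Real.log φ) / n < Real.log B ↔ φ < Real.exp (B ^ n) := by
  have hn' : (0 : ℝ) < n := by exact_mod_cast hn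
  rw [div_lt_iff₀ hn', mul_comm, ← Real.log_pow,
    Real.log_lt_log_iff (Real.log_pos hφ) (by positivity), Real.log_lt_iff_lt_exp (by linarith)]

lemma eventually_le_exp_pow {φ : ℕ → ℝ} (hφ : Tendsto φ atTop atTop) {A : ENNReal}
    (hA : ENNReal.log A =
      limsup (fun n : ℕ => ((Real.log (Real.log (φ n)) / (n : ℝ) : ℝ) : EReal)) atTop)
    {B : ℝ} (hB : 0 < B) (h : A < ENNReal.ofReal B) :
    ∀ᶠ n in atTop, φ n ≤ Real.exp (B ^ n) := by
  have h1 := ENNReal.log_strictMono h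
  rw [hA, log_ofReal_eq hB] at h1
  filter_upwards [eventually_lt_of_limsup_lt h1, hφ.eventually_gt_atTop 1, eventually_gt_atTop 0]
    with n h2 h3 h4
  exact ((log_log_div_lt_iff h3 hB h4).1 (by exact_mod_cast h2)).le

lemma frequently_exp_pow_le {φ : ℕ → ℝ} (hφ : Tendsto φ atTop atTop) {A : ENNReal}
    (hA : ENNReal.log A =
      limsup (fun n : ℕ => ((Real.log (Real.log (φ n)) / (n : ℝ) : ℝ) : EReal)) atTop)
    {B : ℝ} (hB : 0 < B) (h : ENNReal.ofReal B < A) :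
    ∃ᶠ n in atTop, Real.exp (B ^ n) ≤ φ n := by
  have h1 := ENNReal.log_strictMono h
  rw [hA, log_ofReal_eq hB] at h1
  refine ((frequently_lt_of_lt_limsup (by isBoundedDefault) h1).and_eventually
    ((hφ.eventually_gt_atTop 1).and (eventually_gt_atTop 0))).mono fun n hn => ?_
  by_contra! h2
  have h3 := (log_log_div_lt_iff hn.2.1 hB hn.2.2).2 h2
  have h4 : Real.log B < Real.log (Real.log (φ n)) / (n : ℝ) := by exact_mod_cast hn.1
  linarith

lemma ofReal_one_div_one_add (r : NNReal) :
    ENNReal.ofReal (1 / (1 + (r : ℝ))) = (1 + (r : ENNReal))⁻¹ := by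
  rw [one_div, ENNReal.ofReal_inv_of_pos (by positivity), ENNReal.ofReal_add zero_le_one r.coe_nonneg]
  simp

theorem proposition3p1 (m : ℕ) (t : Fin (m + 1) → ℝ) (ht : ∀ i, 0 ≤ t i) (ht0 : ∃ i, t i ≠ 0)
    (φ : ℕ → ℝ) (hφpos : ∀ n : ℕ, 1 ≤ n → 0 < φ n)
    (hφ : Filter.Tendsto φ Filter.atTop Filter.atTop)
    (A : ENNReal)
    (hA : ENNReal.log A =
      Filter.limsup (fun n : ℕ => ((Real.log (Real.log (φ n)) / (n : ℝ) : ℝ) : EReal))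
        Filter.atTop) :
    dimH (ND t φ) = 1 / (1 + A) ∧ dimH (ND' t φ) = 1 / (1 + A) := by
  have hA1 := one_le_of_log_eq_limsup hφ hA
  have hsub : dimH (ND t φ) ≤ dimH (ND' t φ) :=
    dimH_mono fun x hx => ⟨hx.1, eventually_atTop.2 ⟨1, hx.2⟩⟩
  have hlow : 1 / (1 + A) ≤ dimH (ND t φ) := by
    rw [one_div, ENNReal.inv_le_iff_inv_le]
    refine le_of_forall_gt_imp_ge_of_dense fun b hb => ?_
    rcases eq_or_ne b ⊤ with rfl | hbtop
    · exact le_top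
    lift b to NNReal using hbtop
    have hb1 : (1 : ENNReal) ≤ b := le_self_add.trans hb.le
    obtain ⟨r, hr⟩ : ∃ r : NNReal, b = 1 + r := exists_add_of_le (by exact_mod_cast hb1)
    rw [hr, ENNReal.coe_add, ENNReal.coe_one] at hb ⊢
    have hAr : A < r := (ENNReal.add_lt_add_iff_left ENNReal.one_ne_top).1 hb
    have hr1 : (1 : ℝ) < r := by exact_mod_cast hA1.trans_lt hAr
    have := le_dimH_ND ht ht0 hr1
      (eventually_le_exp_pow hφ hA (by linarith) (by rwa [ENNReal.ofReal_coe_nnreal]))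
    rw [ofReal_one_div_one_add] at this
    exact ENNReal.inv_le_iff_inv_le.1 this
  have hup : dimH (ND' t φ) ≤ 1 / (1 + A) := by
    have hone := dimH_ND'_le ht ht0 hφ le_rfl (Or.inl rfl)
    -- For `A = 1` no `c` with `1 ≤ c < A` exists, but `c = 1` needs no lower bound on `φ`.
    rcases hA1.eq_or_lt with rfl | hA1
    · have h := ofReal_one_div_one_add 1
      rw [NNReal.coe_one, ENNReal.coe_one] at h
      rwa [h, ← one_div] at hone
    rw [one_div, ← ENNReal.le_inv_iff_le_inv]
    have key : ∀ r : NNReal, 1 ≤ r → (r : ENNReal) < A → 1 + (r : ENNReal) ≤ (dimH (ND' t φ))⁻¹ := by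
      intro r hr1 hrA
      obtain ⟨r', hrr', hr'A⟩ := ENNReal.lt_iff_exists_nnreal_btwn.1 hrA
      have hrr : (r : ℝ) < r' := by exact_mod_cast hrr'
      have hr1' : (1 : ℝ) ≤ r := by exact_mod_cast hr1
      have := dimH_ND'_le ht ht0 hφ hr1' (Or.inr ⟨r', hrr,
        frequently_exp_pow_le hφ hA (by linarith) (by rwa [ENNReal.ofReal_coe_nnreal])⟩)
      rw [ofReal_one_div_one_add] at this
      exact ENNReal.le_inv_iff_le_inv.1 this
    rw [add_comm]
    refine add_le_of_le_tsub_right_of_le ?_ ?_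
    · exact le_self_add.trans (key 1 le_rfl (by exact_mod_cast hA1))
    refine le_of_forall_lt_imp_le_of_dense fun b hb => ?_
    lift b to NNReal using hb.ne_top
    have h := key (max 1 b) (le_max_left _ _) (by rw [ENNReal.coe_max]; exact max_lt hA1 hb)
    refine ENNReal.le_sub_of_add_le_right ENNReal.one_ne_top (le_trans ?_ h)
    rw [add_comm]
    gcongr
    exact le_max_right _ _
  exact ⟨le_antisymm (hsub.trans hup) hlow, le_antisymm hup (hlow.trans hsub)⟩
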